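/- Let $S$ be a closed, densely defined symmetric operator on a complex Hilbert space $\mathcal H$, with adjoint $S^*$, and let $(\mathcal K,\Gamma_0,\Gamma_1)$ be a boundary triplet for $S$: $\mathcal K$ is a complex Hilbert space (possibly infinite dimensional) and $\Gamma_0,\Gamma_1:\operatorname{dom}(S^*)\to\mathcal K$ are linear maps such that $\mathbf\Gamma=(\Gamma_0,\Gamma_1):\operatorname{dom}(S^*)\to\mathcal K\oplus\mathcal K$ is surjective and $$\langle f,S^*g\rangle_{\mathcal H}-\langle S^*f,g\rangle_{\mathcal H}=\omega(\mathbf\Gamma f,\mathbf\Gamma g)\quad\text{for all } f,g\in\operatorname{dom}(S^*),$$ where $\omega(u,v)=\langle u_0,v_1\rangle_{\mathcal K}-\langle u_1,v_0\rangle_{\mathcal K}$ (inner products are linear in the second argument). Let $\mathcal M(z)=\mathbf\Gamma(\ker(S^*-z))$ be the Cauchy data space, and let $\Phi_-(S^*)$ be the set of $z\in\mathbb C$ for which $\operatorname{ran}(S^*-z)$ has finite codimension in $\mathcal H$. Fix $z_0\in\Phi_-(S^*)$. There is an orthogonal splitting $\mathcal H=\mathcal H_{sim}\oplus\mathcal H_{sa}$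 with respect to which $S=S_{sim}\oplus S_{sa}$ is diagonal, with $S_{sa}$ self-adjoint in $\mathcal H_{sa}$ and $S_{sim}$ simple in $\mathcal H_{sim}$ (that is, $0$ is the only closed reducing subspace for $S_{sim}$ on which it is self-adjoint). There is also a family $G_z$ of bounded invertible operators on $\mathcal K\oplus\mathcal K$, analytic in $z$ near $z_0$, with $G_{z_0}=I$ and $G_z\mathcal M(z_0)=\mathcal M(z)$. For every such splitting and every $v\in\mathcal M(z_0)$ there is a unique $f\in\mathcal H_{sim}$ with $S_{sim}^*f=z_0f$ and $\mathbf\Gamma f=v$, and $$\min\big\{\|g\|_{\mathcal H}^2 : g\in\operatorname{dom}(S^*),\ (S^*-z_0)g=0,\ \mathbf\Gamma g=v\big\}=\|f\|_{\mathcal H_{sim}}^2,$$ the minimum being attained. If moreover $z_0$ is real, then for every such family $G_z$ the crossing form $$\mathfrak q[v]:=\frac{d}{dz}\,\omega(v,G_zv)\Big|_{z=z_0}$$ exists (as a complex derivative) and equals this common value: $$\mathfrak q[v]=\min\big\{\|g\|_{\mathcal H}^2 : g\in\operatorname{dom}(S^*),\ (S^*-z_0)g=0,\ \mathbf\Gamma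 g=v\big\}=\|f\|_{\mathcal H_{sim}}^2 .$$ -/

import Mathlib

open scoped Topology LinearPMap

noncomputable section

namespace CauchyData

section Operators

variable {E : Type*} [NormedAddCommGroup E] [InnerProductSpace ℂ E]

/-- The operator `T - z` on the domain of `T`. -/
def shift (T : E →ₗ.[ℂ] E) (z : ℂ) : T.domain →ₗ[ℂ] E :=
  T.toFun - z • T.domain.subtype

/-- `Φ₋(T)`: the complex numbers `z` for which the range of `T - z` has finite codimension. -/
def PhiMinus (T : E →ₗ.[ℂ] E) : Set ℂ :=
  {z | FiniteDimensional ℂ (E ⧸ LinearMap.range (shift T z))}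

/-- The part of `T` in a subspace `M`, an operator in `M`: its domain consists of those
`x ∈ M ∩ dom T` with `T x ∈ M`, and it acts as `T`. If `M` reduces `T`, the condition `T x ∈ M`
is automatic and this is the restriction of `T` to `M ∩ dom T`. -/
def part (T : E →ₗ.[ℂ] E) (M : Submodule ℂ E) : M →ₗ.[ℂ] M where
  domain :=
    { carrier := {x | ∃ h : (x : E) ∈ T.domain, T ⟨x, h⟩ ∈ M}
      zero_mem' := ⟨T.domain.zero_mem, by
        have : T ⟨0, T.domain.zero_mem⟩ = 0 := T.map_zero
        simp [this]⟩
      add_mem' := by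
        rintro x y ⟨hx, hx'⟩ ⟨hy, hy'⟩
        refine ⟨T.domain.add_mem hx hy, ?_⟩
        have := M.add_mem hx' hy'
        rwa [← T.map_add] at this
      smul_mem' := by
        rintro c x ⟨hx, hx'⟩
        refine ⟨T.domain.smul_mem c hx, ?_⟩
        have := M.smul_mem c hx'
        rwa [← T.map_smul] at this }
  toFun :=
    { toFun := fun x => ⟨T ⟨x.1, x.2.1⟩, x.2.2⟩
      map_add' := fun x y =>
        Subtype.ext (T.map_add ⟨x.1, x.2.1⟩ ⟨y.1, y.2.1⟩)
      map_smul' := fun c x =>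
        Subtype.ext (T.map_smul c ⟨x.1, x.2.1⟩) }

/-- `M` reduces `T`: the orthogonal projection onto `M` maps `dom T` into itself and commutes
with `T` there; equivalently, `T` is diagonal with respect to `E = M ⊕ Mᗮ`. -/
def IsReducing (T : E →ₗ.[ℂ] E) (M : Submodule ℂ E) [M.HasOrthogonalProjection] : Prop :=
  ∀ x : T.domain, ∃ h : M.starProjection (x : E) ∈ T.domain,
    T ⟨M.starProjection (x : E), h⟩ = M.starProjection (T x)

/-- `T` is simple: the zero subspace is the only (closed) reducing subspace in which the part of
`T` is self-adjoint. -/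
def IsSimple (T : E →ₗ.[ℂ] E) : Prop :=
  ∀ (N : Submodule ℂ E) [CompleteSpace N], IsReducing T N → IsSelfAdjoint (part T N) → N = ⊥

/-- `M` is the simple part of the space in an orthogonal splitting `E = M ⊕ Mᗮ` with respect to
which `T` is diagonal, with a simple part in `M` and a self-adjoint part in `Mᗮ`. -/
structure IsSimplePart [CompleteSpace E] (T : E →ₗ.[ℂ] E) (M : Submodule ℂ E)
    [CompleteSpace M] : Prop where
  reducing : IsReducing T M
  simple : IsSimple (part T M)
  selfAdjoint : IsSelfAdjoint (part T Mᗮ)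

end Operators

section Triplets

variable {H : Type*} [NormedAddCommGroup H] [InnerProductSpace ℂ H] [CompleteSpace H]
variable {K : Type*} [NormedAddCommGroup K] [InnerProductSpace ℂ K]

/-- The symplectic form `ω(u, v) = ⟪u₀, v₁⟫ - ⟪u₁, v₀⟫` on `K ⊕ K` (inner products are linear
in the second argument). -/
def omega (u v : K × K) : ℂ :=
  inner ℂ u.1 v.2 - inner ℂ u.2 v.1

/-- A boundary triplet `(K, Γ₀, Γ₁)` for `S`: linear maps `Γ₀, Γ₁ : dom S* → K` such that
`(Γ₀, Γ₁)` is onto `K ⊕ K` and the abstract Green identity holds. -/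
structure BoundaryTriplet (S : H →ₗ.[ℂ] H) (K : Type*) [NormedAddCommGroup K]
    [InnerProductSpace ℂ K] where
  Γ₀ : S†.domain →ₗ[ℂ] K
  Γ₁ : S†.domain →ₗ[ℂ] K
  surjective : Function.Surjective (Γ₀.prod Γ₁)
  green : ∀ f g : S†.domain,
    inner ℂ (f : H) (S† g) - inner ℂ (S† f) (g : H)
      = inner ℂ (Γ₀ f) (Γ₁ g) - inner ℂ (Γ₁ f) (Γ₀ g)

namespace BoundaryTriplet

variable {S : H →ₗ.[ℂ] H}

/-- The trace map `Γ f = (Γ₀ f, Γ₁ f)`. -/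
def trace (B : BoundaryTriplet S K) : S†.domain →ₗ[ℂ] K × K :=
  B.Γ₀.prod B.Γ₁

/-- The Cauchy data space `M(z) = Γ (ker (S* - z))`. -/
def cauchyData (B : BoundaryTriplet S K) (z : ℂ) : Submodule ℂ (K × K) :=
  (LinearMap.ker (shift S† z)).map B.trace

/-- `G` is, near `z₀`, an analytic family of bounded invertible operators on `K ⊕ K` with
`G z₀ = 1` and `G z (M(z₀)) = M(z)`. -/
structure IsTransport (B : BoundaryTriplet S K) (z₀ : ℂ)
    (G : ℂ → (K × K) →L[ℂ] (K × K)) : Prop where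
  analytic : AnalyticAt ℂ G z₀
  at_base : G z₀ = 1
  invertible : ∀ᶠ z in 𝓝 z₀, IsUnit (G z)
  map_eq : ∀ᶠ z in 𝓝 z₀, (B.cauchyData z₀).map (G z).toLinearMap = B.cauchyData z

/-- `f ∈ M` solves `(S|_M)* f = z f` (adjoint taken in `M`) and `Γ f = v`. -/
def IsPartSolution (B : BoundaryTriplet S K) (M : Submodule ℂ H) [CompleteSpace M] (z : ℂ)
    (v : K × K) (f : M) : Prop :=
  (∃ h : f ∈ (part S M)†.domain, (part S M)† ⟨f, h⟩ = z • f) ∧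
    ∃ h : (f : H) ∈ S†.domain, B.trace ⟨f, h⟩ = v

end BoundaryTriplet

end Triplets

end CauchyData

end

open scoped Topology LinearPMap

noncomputable section

namespace CauchyData

/-! ### Unbounded operators through their graphs: parts, reducing subspaces, adjoints -/

section Graphs

variable {E : Type*} [NormedAddCommGroup E] [InnerProductSpace ℂ E]

/-! Write `P` for the projection onto the simple part. On the self-adjoint part `S†` coincides with
`S`, and `Γ` vanishes exactly on `dom S`. Hence `P` preserves traces, and since it also commutes
with `S†`, Cauchy data can be computed inside the simple part. There a solution of `S† f = z f` is
determined by its trace, because a solution with zero trace is an eigenvector of `S`, which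
simplicity forbids. Every competitor `g` therefore projects to the same `f`, and `‖P g‖ ≤ ‖g‖` gives
the minimum.

For `z ∈ Φ₋`, simplicity also makes `S† - z` onto in the simple part: the range is closed by finite
codimension, and its orthogonal complement consists of eigenvectors of `S`. Together with a lower
bound for `S - z` and boundedness of `Γ` in the graph norm, this yields the a priori estimate
`IsSimplePart.exists_norm_le`. It drives both remaining points. It bounds `Γ` below on the kernel,
so that a Neumann-type perturbation of the kernel (`exists_analytic_transport`) descends to the
family `G`. It also makes solutions `f_z` with trace `G z v` converge to `f`. For real `z₀` Green's
identity reads `ω(v, G z v) = (z - z₀)⟪f, f_z⟫`, so the difference quotient tends to `‖f‖²`.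

The splitting itself comes from the largest subspace invariant under the resolvents of `S` at `±i`;
its orthogonal complement is the simple part. -/

theorem mem_part_graph {T : E →ₗ.[ℂ] E} {M : Submodule ℂ E} {x y : M} :
    (x, y) ∈ (part T M).graph ↔ ((x : E), (y : E)) ∈ T.graph := by
  simp only [LinearPMap.mem_graph_iff]
  constructor
  · rintro ⟨u, rfl, rfl⟩
    exact ⟨⟨u.1, u.2.1⟩, rfl, rfl⟩
  · rintro ⟨u, hu, hy⟩
    have h : (x : E) ∈ T.domain := hu ▸ u.2
    have hu' : u = ⟨x, h⟩ := Subtype.ext hu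
    subst hu'
    exact ⟨⟨x, h, by rw [hy]; exact y.2⟩, rfl, Subtype.ext hy⟩

theorem isReducing_iff {T : E →ₗ.[ℂ] E} {M : Submodule ℂ E} [M.HasOrthogonalProjection] :
    IsReducing T M ↔
      ∀ x y, (x, y) ∈ T.graph → (M.starProjection x, M.starProjection y) ∈ T.graph := by
  simp only [LinearPMap.mem_graph_iff]
  constructor
  · rintro h x y ⟨u, rfl, rfl⟩
    obtain ⟨h₁, h₂⟩ := h u
    exact ⟨⟨_, h₁⟩, rfl, h₂⟩
  · intro h x
    obtain ⟨u, hu, hy⟩ := h x (T x) ⟨x, rfl, rfl⟩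
    refine ⟨hu ▸ u.2, ?_⟩
    rw [← hy]
    congr 1
    exact Subtype.ext hu.symm

theorem IsReducing.orthogonal {T : E →ₗ.[ℂ] E} {M : Submodule ℂ E} [M.HasOrthogonalProjection]
    (h : IsReducing T M) : IsReducing T Mᗮ := by
  rw [isReducing_iff] at h ⊢
  intro x y hxy
  rw [Submodule.starProjection_orthogonal_val, Submodule.starProjection_orthogonal_val]
  exact T.graph.sub_mem hxy (h x y hxy)

theorem isFormalAdjoint_self_iff {T : E →ₗ.[ℂ] E} :
    T.IsFormalAdjoint T ↔ ∀ x y x' y', (x, y) ∈ T.graph → (x', y') ∈ T.graph →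
      inner ℂ y x' = inner ℂ x y' := by
  simp only [LinearPMap.mem_graph_iff]
  constructor
  · rintro h x y x' y' ⟨u, rfl, rfl⟩ ⟨u', rfl, rfl⟩
    exact h u u'
  · intro h u u'
    exact h _ _ _ _ ⟨u, rfl, rfl⟩ ⟨u', rfl, rfl⟩

theorem isFormalAdjoint_part {T : E →ₗ.[ℂ] E} (h : T.IsFormalAdjoint T) (M : Submodule ℂ E) :
    (part T M).IsFormalAdjoint (part T M) := by
  rw [isFormalAdjoint_self_iff] at h ⊢
  intro x y x' y' hx hx'
  exact h _ _ _ _ (mem_part_graph.1 hx) (mem_part_graph.1 hx')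

theorem dense_part_domain {T : E →ₗ.[ℂ] E} {M : Submodule ℂ E} [M.HasOrthogonalProjection]
    (hT : Dense (T.domain : Set E)) (h : IsReducing T M) :
    Dense ((part T M).domain : Set M) := by
  have hs : Function.Surjective M.orthogonalProjectionOnto := fun x =>
    ⟨x, Submodule.orthogonalProjectionOnto_mem_subspace_eq_self x⟩
  refine (hs.denseRange.dense_image M.orthogonalProjectionOnto.continuous hT).mono ?_
  rintro _ ⟨x, hx, rfl⟩
  have := isReducing_iff.1 h x (T ⟨x, hx⟩) (LinearPMap.mem_graph T ⟨x, hx⟩)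
  have : (M.orthogonalProjectionOnto x, M.orthogonalProjectionOnto (T ⟨x, hx⟩)) ∈ (part T M).graph :=
    mem_part_graph.2 this
  exact LinearPMap.mem_domain_of_mem_graph this

/-- A symmetric operator minus a nonreal number is bounded below. -/
theorem abs_im_mul_norm_le {T : E →ₗ.[ℂ] E} (hT : T.IsFormalAdjoint T) (z : ℂ) {x y : E}
    (h : (x, y) ∈ T.graph) : |z.im| * ‖x‖ ≤ ‖y - z • x‖ := by
  have h₁ := isFormalAdjoint_self_iff.1 hT _ _ _ _ h h
  have him : (inner ℂ x y : ℂ).im = 0 := by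
    have : (starRingEnd ℂ) (inner ℂ x y) = inner ℂ x y := by rw [inner_conj_symm, h₁]
    exact Complex.conj_eq_iff_im.1 this
  have h₂ : (inner ℂ x (y - z • x) : ℂ).im = - (z.im * ‖x‖ ^ 2) := by
    have hn : inner ℂ x x = ((‖x‖ ^ 2 : ℝ) : ℂ) := by
      simp [inner_self_eq_norm_sq_to_K]
    rw [inner_sub_right, inner_smul_right, hn, Complex.sub_im, him, Complex.im_mul_ofReal,
      zero_sub]
  have h₃ : |z.im| * ‖x‖ ^ 2 ≤ ‖x‖ * ‖y - z • x‖ := by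
    calc |z.im| * ‖x‖ ^ 2 = |(inner ℂ x (y - z • x) : ℂ).im| := by
          rw [h₂, abs_neg, abs_mul, abs_of_nonneg (sq_nonneg ‖x‖)]
      _ ≤ ‖(inner ℂ x (y - z • x) : ℂ)‖ := Complex.abs_im_le_norm _
      _ ≤ _ := norm_inner_le_norm _ _
  rcases (norm_nonneg x).eq_or_lt with h0 | h0
  · rw [← h0, mul_zero]; exact norm_nonneg _
  · refine le_of_mul_le_mul_left ?_ h0
    linarith

variable [CompleteSpace E]

theorem mem_adjoint_graph {T : E →ₗ.[ℂ] E} (hT : Dense (T.domain : Set E)) {x y : E} :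
    (x, y) ∈ T†.graph ↔ ∀ a b, (a, b) ∈ T.graph → inner ℂ b x = inner ℂ a y := by
  rw [LinearPMap.adjoint_graph_eq_graph_adjoint hT, Submodule.mem_adjoint_iff]
  simp only [sub_eq_zero]

/-- This is `T†† ≤ T`. A closed graph equals its double orthogonal complement in the Hilbert sum,
and the rotation `(u₁, u₂) ↦ (u₂, -u₁)` carries its orthogonal complement into the graph of `T†`. -/
theorem mem_graph_of_forall_adjoint {T : E →ₗ.[ℂ] E} (hT : Dense (T.domain : Set E))
    (hc : T.IsClosed) {x y : E}
    (h : ∀ a b, (a, b) ∈ T†.graph → inner ℂ b x = inner ℂ a y) : (x, y) ∈ T.graph := by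
  let e := WithLp.prodContinuousLinearEquiv 2 ℂ E E
  let G : Submodule ℂ (WithLp 2 (E × E)) := T.graph.comap e.toLinearEquiv.toLinearMap
  have hG : IsClosed (G : Set (WithLp 2 (E × E))) := hc.preimage e.continuous
  have : CompleteSpace G := hG.completeSpace_coe
  have key : WithLp.toLp 2 (x, y) ∈ Gᗮᗮ := by
    rw [Submodule.mem_orthogonal]
    intro u hu
    rw [Submodule.mem_orthogonal] at hu
    have hu' : (u.snd, -u.fst) ∈ T†.graph := by
      rw [mem_adjoint_graph hT]
      intro a b hab
      have := hu (WithLp.toLp 2 (a, b)) hab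
      rw [WithLp.prod_inner_apply] at this
      rw [inner_neg_right]
      exact eq_neg_of_add_eq_zero_right this
    have := h _ _ hu'
    rw [inner_neg_left] at this
    rw [WithLp.prod_inner_apply]
    change inner ℂ u.fst x + inner ℂ u.snd y = 0
    rw [← this]; ring
  rw [Submodule.orthogonal_orthogonal] at key
  exact key

theorem graph_le_adjoint_graph {T : E →ₗ.[ℂ] E} (hT : Dense (T.domain : Set E))
    (hs : T.IsFormalAdjoint T) : T.graph ≤ T†.graph :=
  LinearPMap.le_graph_iff.2 (hs.le_adjoint hT)

theorem IsReducing.adjoint {T : E →ₗ.[ℂ] E} (hT : Dense (T.domain : Set E)) {M : Submodule ℂ E}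
    [M.HasOrthogonalProjection] (h : IsReducing T M) : IsReducing T† M := by
  rw [isReducing_iff] at h ⊢
  intro x y hxy
  rw [mem_adjoint_graph hT] at hxy ⊢
  intro a b hab
  rw [← Submodule.inner_starProjection_left_eq_right, ← Submodule.inner_starProjection_left_eq_right]
  exact hxy _ _ (h a b hab)

/-- Taking parts commutes with adjoints: for vectors of `M`, a test pair from `T` may be replaced by
its projection to `M`, which lies in the part. -/
theorem mem_part_adjoint_graph {T : E →ₗ.[ℂ] E} (hT : Dense (T.domain : Set E))
    {M : Submodule ℂ E} [CompleteSpace M] (h : IsReducing T M) {x y : M} :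
    (x, y) ∈ (part T M)†.graph ↔ ((x : E), (y : E)) ∈ T†.graph := by
  have hd : Dense ((part T M).domain : Set M) := dense_part_domain hT h
  rw [mem_adjoint_graph hT, mem_adjoint_graph (T := part T M) hd]
  constructor
  · intro hxy a b hab
    have h₁ : (M.orthogonalProjectionOnto a, M.orthogonalProjectionOnto b) ∈ (part T M).graph :=
      mem_part_graph.2 (isReducing_iff.1 h a b hab)
    have := hxy _ _ h₁
    rwa [Submodule.inner_orthogonalProjectionOnto_eq_of_mem_right,
      Submodule.inner_orthogonalProjectionOnto_eq_of_mem_right] at this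
  · intro hxy a b hab
    exact hxy _ _ (mem_part_graph.1 hab)

theorem isSelfAdjoint_of_domain_eq_top {T : E →ₗ.[ℂ] E} (hs : T.IsFormalAdjoint T)
    (h : T.domain = ⊤) : IsSelfAdjoint T := by
  have hd : Dense (T.domain : Set E) := by rw [h]; exact dense_univ
  have hle : T ≤ T† := hs.le_adjoint hd
  have hdom : T.domain = T†.domain := le_antisymm hle.1 (by rw [h]; exact le_top)
  exact (LinearPMap.eq_of_le_of_domain_eq hle hdom).symm

/-- A closed subspace of the graph of `T` on which `T - z` is bounded below has a closed image
under `T - z`. -/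
theorem isClosed_image_sub_smul (G : Submodule ℂ (E × E)) (hG : IsClosed (G : Set (E × E)))
    (z : ℂ) (c : ℝ) (h : ∀ p ∈ G, ‖p.1‖ ≤ c * ‖p.2 - z • p.1‖) :
    IsClosed {y : E | ∃ x, (x, y + z • x) ∈ G} := by
  have : CompleteSpace G := hG.completeSpace_coe
  let A : G →L[ℂ] E := (ContinuousLinearMap.snd ℂ E E - z • ContinuousLinearMap.fst ℂ E E).comp
    G.subtypeL
  have hA : ∀ p : G, A p = p.1.2 - z • p.1.1 := fun p => rfl
  have hb : ∀ p : G, ‖p‖ ≤ (Real.toNNReal (1 + (1 + ‖z‖) * |c|) : NNReal) * ‖A p‖ := by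
    intro p
    have h1 : ‖p.1.1‖ ≤ |c| * ‖A p‖ :=
      (h p.1 p.2).trans (mul_le_mul_of_nonneg_right (le_abs_self c) (norm_nonneg _))
    have h2 : ‖p.1.2‖ ≤ ‖A p‖ + ‖z‖ * ‖p.1.1‖ := by
      calc ‖p.1.2‖ = ‖A p + z • p.1.1‖ := by rw [hA, sub_add_cancel]
        _ ≤ _ := (norm_add_le _ _).trans (by rw [norm_smul])
    have hz := norm_nonneg z
    have h3 : ‖z‖ * ‖p.1.1‖ ≤ ‖z‖ * (|c| * ‖A p‖) := mul_le_mul_of_nonneg_left h1 hz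
    have h4 := norm_nonneg (A p)
    have h5 : 0 ≤ |c| * ‖A p‖ := by positivity
    have h6 : 0 ≤ ‖z‖ * (|c| * ‖A p‖) := by positivity
    rw [Real.coe_toNNReal _ (by positivity)]
    change max ‖p.1.1‖ ‖p.1.2‖ ≤ _
    refine max_le ?_ ?_ <;> nlinarith
  have hcl := (A.antilipschitz_of_bound hb).isClosed_range A.uniformContinuous
  convert hcl using 1
  ext y
  constructor
  · rintro ⟨x, hx⟩
    exact ⟨⟨_, hx⟩, by rw [hA]; simp⟩
  · rintro ⟨p, rfl⟩
    exact ⟨p.1.1, by rw [hA, sub_add_cancel]; exact p.2⟩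

/-- The range of `A - z` is closed by the lower bound, and a vector orthogonal to it is an
eigenvector of `A† = A` at the nonreal number `conj z`, hence zero. -/
theorem IsSelfAdjoint.exists_sub_smul_eq {A : E →ₗ.[ℂ] E} (hA : IsSelfAdjoint A) {z : ℂ}
    (hz : z.im ≠ 0) (y : E) : ∃ x, (x, y + z • x) ∈ A.graph := by
  have hd := hA.dense_domain
  have hAA : A† = A := hA
  have hs : A.IsFormalAdjoint A := by
    have := LinearPMap.adjoint_isFormalAdjoint hd
    rwa [hAA] at this
  have hz' : 0 < |z.im| := abs_pos.2 hz
  have hcl := isClosed_image_sub_smul A.graph hA.isClosed z |z.im|⁻¹ (fun p hp => by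
    rw [inv_mul_eq_div, le_div_iff₀ hz', mul_comm]
    exact abs_im_mul_norm_le hs z hp)
  let R : Submodule ℂ E := A.graph.map (LinearMap.snd ℂ E E - z • LinearMap.fst ℂ E E)
  have hR : (R : Set E) = {y : E | ∃ x, (x, y + z • x) ∈ A.graph} := by
    ext y
    constructor
    · rintro ⟨p, hp, rfl⟩
      exact ⟨p.1, by simpa using hp⟩
    · rintro ⟨x, hx⟩
      exact ⟨_, hx, by simp⟩
  rw [← hR] at hcl
  have : CompleteSpace R := hcl.completeSpace_coe
  have hbot : Rᗮ = ⊥ := by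
    rw [eq_bot_iff]
    intro v hv
    rw [Submodule.mem_orthogonal] at hv
    have hv' : (v, (starRingEnd ℂ) z • v) ∈ A.graph := by
      rw [← hAA, mem_adjoint_graph hd]
      intro a b hab
      have := hv (b - z • a) ⟨_, hab, rfl⟩
      rw [inner_sub_left, inner_smul_left, sub_eq_zero] at this
      rw [this, inner_smul_right]
    have := abs_im_mul_norm_le hs ((starRingEnd ℂ) z) hv'
    rw [sub_self, norm_zero, Complex.conj_im, abs_neg] at this
    have : ‖v‖ ≤ 0 := by nlinarith [norm_nonneg v]
    simpa using this
  have htop : R = ⊤ := by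
    rwa [Submodule.orthogonal_eq_bot_iff] at hbot
  have : y ∈ (R : Set E) := by rw [htop]; trivial
  rwa [hR] at this

/-- The range criterion for self-adjointness. Density of the domain is a consequence here, not an
assumption. -/
theorem isSelfAdjoint_of_exists_sub_smul_eq {A : E →ₗ.[ℂ] E} (hs : A.IsFormalAdjoint A)
    (h₁ : ∀ y, ∃ x, (x, y + Complex.I • x) ∈ A.graph)
    (h₂ : ∀ y, ∃ x, (x, y + (-Complex.I) • x) ∈ A.graph) : IsSelfAdjoint A := by
  have hd : Dense (A.domain : Set E) := by
    rw [Submodule.dense_iff_topologicalClosure_eq_top,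
      Submodule.topologicalClosure_eq_top_iff, eq_bot_iff]
    intro y hy
    rw [Submodule.mem_orthogonal] at hy
    obtain ⟨x, hx⟩ := h₁ y
    have hxy : inner ℂ x y = (0 : ℂ) := hy x (LinearPMap.mem_domain_of_mem_graph hx)
    have hself := isFormalAdjoint_self_iff.1 hs _ _ _ _ hx hx
    rw [inner_add_left, inner_add_right, hxy, ← inner_conj_symm, hxy, inner_smul_left,
      inner_smul_right, Complex.conj_I, map_zero, zero_add, zero_add] at hself
    have : inner ℂ x x = (0 : ℂ) := by
      have h2 : (2 * Complex.I) * inner ℂ x x = 0 := by linear_combination -hself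
      simpa using h2
    have hx0 : x = 0 := inner_self_eq_zero.1 this
    subst hx0
    have : (0, y) ∈ A.graph := by simpa using hx
    exact (Submodule.mem_bot ℂ).2 (A.graph_fst_eq_zero_snd this rfl)
  apply LinearPMap.eq_of_eq_graph
  refine le_antisymm ?_ (graph_le_adjoint_graph hd hs)
  rintro ⟨x, y⟩ hxy
  obtain ⟨u, hu⟩ := h₁ (y - Complex.I • x)
  -- Here `x - u` lies in the kernel of `A† - i`, which is orthogonal to the range of `A + i`; but
  -- that range is everything.
  have hdiff : x - u = 0 := by
    obtain ⟨w, hw⟩ := h₂ (x - u)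
    have hm := (A†).graph.sub_mem hxy (graph_le_adjoint_graph hd hs hu)
    have := (mem_adjoint_graph hd).1 hm _ _ hw
    simp only [inner_add_left, inner_smul_left, inner_sub_right, inner_add_right,
      inner_smul_right, map_neg, Complex.conj_I, neg_neg, inner_sub_left] at this
    rw [← inner_self_eq_zero (𝕜 := ℂ)]
    simp only [inner_sub_left, inner_sub_right]
    linear_combination this
  have hxu : x = u := sub_eq_zero.1 hdiff
  subst hxu
  simpa using hu

end Graphs

/-! ### Splitting off the self-adjoint part -/

section Simple

variable {E : Type*} [NormedAddCommGroup E] [InnerProductSpace ℂ E]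

/-- By symmetry an eigenvalue is real and the line spanned by an eigenvector is reducing;
multiplication by a real number is self-adjoint on that line. -/
theorem IsSimple.eq_zero_of_smul_mem_graph [CompleteSpace E] {A : E →ₗ.[ℂ] E} (h : IsSimple A)
    (hs : A.IsFormalAdjoint A) {x : E} {c : ℂ} (hx : (x, c • x) ∈ A.graph) : x = 0 := by
  by_contra hx0
  have hc : (starRingEnd ℂ) c = c := by
    have := isFormalAdjoint_self_iff.1 hs _ _ _ _ hx hx
    rw [inner_smul_left, inner_smul_right] at this
    exact mul_right_cancel₀ (inner_self_ne_zero.2 hx0) this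
  let N : Submodule ℂ E := ℂ ∙ x
  have hN : ∀ y ∈ N, (y, c • y) ∈ A.graph := by
    intro y hy
    obtain ⟨a, rfl⟩ := Submodule.mem_span_singleton.1 hy
    have := A.graph.smul_mem a hx
    rwa [Prod.smul_mk, smul_comm] at this
  have hred : IsReducing A N := by
    rw [isReducing_iff]
    intro u v huv
    have hv : N.starProjection v = c • N.starProjection u := by
      rw [← map_smul, ← sub_eq_zero, ← map_sub, Submodule.starProjection_apply_eq_zero_iff,
        Submodule.mem_orthogonal]
      intro y hy
      have := isFormalAdjoint_self_iff.1 hs _ _ _ _ (hN y hy) huv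
      rw [inner_smul_left, hc] at this
      rw [inner_sub_right, inner_smul_right, this, sub_self]
    rw [hv]
    exact hN _ (Submodule.starProjection_apply_mem N u)
  have hsa : IsSelfAdjoint (part A N) := by
    refine isSelfAdjoint_of_domain_eq_top (isFormalAdjoint_part hs N) ?_
    rw [eq_top_iff]
    intro y _
    have : (y, c • y) ∈ (part A N).graph := mem_part_graph.2 (hN y y.2)
    exact LinearPMap.mem_domain_of_mem_graph this
  have := h N hred hsa
  exact hx0 ((Submodule.span_singleton_eq_bot).1 this)

section

variable [CompleteSpace E] {S : E →ₗ.[ℂ] E} {M : Submodule ℂ E} [CompleteSpace M]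

theorem IsSimplePart.eq_zero_of_smul_mem_graph (h : IsSimplePart S M) (hs : S.IsFormalAdjoint S)
    {x : E} (hxM : x ∈ M) {c : ℂ} (hx : (x, c • x) ∈ S.graph) : x = 0 := by
  have : ((⟨x, hxM⟩ : M), c • (⟨x, hxM⟩ : M)) ∈ (part S M).graph := mem_part_graph.2 hx
  exact congrArg Subtype.val (h.simple.eq_zero_of_smul_mem_graph (isFormalAdjoint_part hs M) this)

theorem IsSimplePart.sub_starProjection_mem_graph (h : IsSimplePart S M)
    (hd : Dense (S.domain : Set E)) {x y : E} (hxy : (x, y) ∈ S†.graph) :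
    (x - M.starProjection x, y - M.starProjection y) ∈ S.graph := by
  have h₁ := isReducing_iff.1 (h.reducing.orthogonal.adjoint hd) x y hxy
  have h₂ : (Mᗮ.orthogonalProjectionOnto x, Mᗮ.orthogonalProjectionOnto y) ∈ (part S Mᗮ)†.graph :=
    (mem_part_adjoint_graph hd h.reducing.orthogonal).2 h₁
  rw [show (part S Mᗮ)† = part S Mᗮ from h.selfAdjoint] at h₂
  have h₃ := mem_part_graph.1 h₂
  rw [← Submodule.starProjection_orthogonal_val, ← Submodule.starProjection_orthogonal_val]
  exact h₃

end

variable {S : E →ₗ.[ℂ] E}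

/-- `N` is contained in and invariant under the resolvent of `S` at `z`. -/
def IsResolventInvariant (S : E →ₗ.[ℂ] E) (z : ℂ) (N : Submodule ℂ E) : Prop :=
  ∀ y ∈ N, ∃ x ∈ N, (x, y + z • x) ∈ S.graph

theorem isResolventInvariant_sSup {z : ℂ} {s : Set (Submodule ℂ E)}
    (h : ∀ N ∈ s, IsResolventInvariant S z N) : IsResolventInvariant S z (sSup s) := by
  intro y hy
  rw [sSup_eq_iSup'] at hy
  refine Submodule.iSup_induction _ (motive := fun y => ∃ x ∈ sSup s, (x, y + z • x) ∈ S.graph)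
    hy ?_ ?_ ?_
  · rintro ⟨N, hN⟩ y hy
    obtain ⟨x, hx, hxy⟩ := h N hN y hy
    exact ⟨x, le_sSup hN hx, hxy⟩
  · exact ⟨0, Submodule.zero_mem _, by simp⟩
  · rintro a b ⟨x, hx, hxa⟩ ⟨x', hx', hxb⟩
    refine ⟨x + x', Submodule.add_mem _ hx hx', ?_⟩
    have := S.graph.add_mem hxa hxb
    rw [Prod.mk_add_mk] at this
    rwa [smul_add, add_add_add_comm]

theorem IsResolventInvariant.topologicalClosure [CompleteSpace E] (hc : S.IsClosed) (hs : S.IsFormalAdjoint S)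
    {z : ℂ} (hz : z.im ≠ 0) {N : Submodule ℂ E} (h : IsResolventInvariant S z N) :
    IsResolventInvariant S z N.topologicalClosure := by
  let G : Submodule ℂ (E × E) := S.graph ⊓ N.topologicalClosure.comap (LinearMap.fst ℂ E E)
  have hG : IsClosed (G : Set (E × E)) :=
    IsClosed.inter hc (N.isClosed_topologicalClosure.preimage continuous_fst)
  have hz' : 0 < |z.im| := abs_pos.2 hz
  have hcl := isClosed_image_sub_smul G hG z |z.im|⁻¹ (fun p hp => by
    rw [inv_mul_eq_div, le_div_iff₀ hz', mul_comm]
    exact abs_im_mul_norm_le hs z hp.1)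
  have hsub : (N : Set E) ⊆ {y : E | ∃ x, (x, y + z • x) ∈ G} := by
    intro y hy
    obtain ⟨x, hx, hxy⟩ := h y hy
    exact ⟨x, hxy, N.le_topologicalClosure hx⟩
  intro y hy
  obtain ⟨x, hx⟩ := closure_minimal hsub hcl hy
  exact ⟨x, hx.2, hx.1⟩

/-- A closed, densely defined symmetric operator splits into a simple and a self-adjoint part. -/
theorem exists_isSimplePart [CompleteSpace E] (hc : S.IsClosed) (hs : S.IsFormalAdjoint S) :
    ∃ (M : Submodule ℂ E) (_ : CompleteSpace M), IsSimplePart S M := by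
  let s : Set (Submodule ℂ E) :=
    {N | IsResolventInvariant S Complex.I N ∧ IsResolventInvariant S (-Complex.I) N}
  let N : Submodule ℂ E := sSup s
  have h₁ : IsResolventInvariant S Complex.I N := isResolventInvariant_sSup fun _ h => h.1
  have h₂ : IsResolventInvariant S (-Complex.I) N := isResolventInvariant_sSup fun _ h => h.2
  have hNc : IsClosed (N : Set E) := by
    have : N.topologicalClosure ≤ N :=
      le_sSup ⟨h₁.topologicalClosure hc hs (by simp), h₂.topologicalClosure hc hs (by simp)⟩
    rw [← le_antisymm this N.le_topologicalClosure]
    exact N.isClosed_topologicalClosure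
  have hmax : ∀ L ∈ s, L ≤ N := fun _ => le_sSup
  clear_value N
  have : CompleteSpace N := hNc.completeSpace_coe
  have hred : IsReducing S N := by
    rw [isReducing_iff]
    intro u v huv
    obtain ⟨x, hxN, hx⟩ := h₁ (N.starProjection (v - Complex.I • u))
      (Submodule.starProjection_apply_mem N _)
    have hxu : N.starProjection u = x := by
      -- Writing `n = (S + i) m` with `m ∈ N`, symmetry moves the operator across: `(S - i)(u - x)`
      -- is `v - i u` minus its projection, hence orthogonal to `m`.
      refine Submodule.eq_starProjection_of_mem_of_inner_eq_zero hxN fun n hn => ?_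
      obtain ⟨m, hmN, hm⟩ := h₂ n hn
      have hsym := isFormalAdjoint_self_iff.1 hs _ _ _ _ (S.graph.sub_mem huv hx) hm
      have hP : inner ℂ (v - Complex.I • u - N.starProjection (v - Complex.I • u)) m = (0 : ℂ) :=
        Submodule.starProjection_inner_eq_zero _ m hmN
      generalize N.starProjection (v - Complex.I • u) = q at *
      simp only [inner_add_left, inner_smul_left, inner_add_right, inner_smul_right,
        Complex.conj_I, inner_sub_left] at *
      linear_combination hP - hsym
    rw [hxu]
    rw [map_sub, map_smul, hxu, sub_add_cancel] at hx
    exact hx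
  have hsa : IsSelfAdjoint (part S N) := by
    refine isSelfAdjoint_of_exists_sub_smul_eq (isFormalAdjoint_part hs N) ?_ ?_
    · intro y
      obtain ⟨x, hxN, hx⟩ := h₁ y y.2
      exact ⟨⟨x, hxN⟩, mem_part_graph.2 hx⟩
    · intro y
      obtain ⟨x, hxN, hx⟩ := h₂ y y.2
      exact ⟨⟨x, hxN⟩, mem_part_graph.2 hx⟩
  refine ⟨Nᗮ, inferInstance, hred.orthogonal, ?_, ?_⟩
  · intro L _ _ hL
    -- A subspace carrying a self-adjoint part is resolvent invariant, so maximality puts it inside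
    -- `N`, while it also lies in `Nᗮ`.
    have hinv : ∀ z : ℂ, z.im ≠ 0 → IsResolventInvariant S z (L.map (Nᗮ).subtype) := by
      rintro z hz _ ⟨y, hy, rfl⟩
      obtain ⟨x, hx⟩ := IsSelfAdjoint.exists_sub_smul_eq hL hz ⟨y, hy⟩
      have hx' : ((x : Nᗮ), ((⟨y, hy⟩ + z • x : L) : Nᗮ)) ∈ (part S Nᗮ).graph :=
        (mem_part_graph (T := part S Nᗮ)).1 hx
      have hx'' : ((x : E), (y : E) + z • (x : E)) ∈ S.graph := (mem_part_graph (T := S)).1 hx'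
      exact ⟨_, ⟨x, x.2, rfl⟩, hx''⟩
    have hle : L.map (Nᗮ).subtype ≤ N := hmax _ ⟨hinv _ (by simp), hinv _ (by simp)⟩
    rw [eq_bot_iff]
    intro y hy
    have hyN : (y : E) ∈ N := hle ⟨y, hy, rfl⟩
    have := (Submodule.mem_orthogonal N _).1 y.2 y hyN
    exact (Submodule.mem_bot ℂ).2 (Subtype.ext (inner_self_eq_zero.1 this))
  · have aux : ∀ (L : Submodule ℂ E) [CompleteSpace L], L = N → IsSelfAdjoint (part S L) := by
      rintro L _ rfl
      exact hsa
    exact aux _ (Submodule.orthogonal_orthogonal N)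

end Simple

/-! ### Bounded one-sided inverses and perturbation of kernels -/

section Banach

theorem exists_rightInverse_of_surjective {D X : Type*} [NormedAddCommGroup D]
    [InnerProductSpace ℂ D] [CompleteSpace D] [NormedAddCommGroup X] [NormedSpace ℂ X]
    [CompleteSpace X] (A : D →L[ℂ] X) (hA : Function.Surjective A) :
    ∃ R : X →L[ℂ] D, ∀ x, A (R x) = x := by
  let N : Submodule ℂ D := A.ker
  have hN : IsClosed (N : Set D) := A.isClosed_ker
  have : CompleteSpace N := hN.completeSpace_coe
  let A' : Nᗮ →L[ℂ] X := A.comp Nᗮ.subtypeL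
  have hinj : A'.ker = ⊥ := by
    rw [eq_bot_iff]
    intro x hx
    have hxN : (x : D) ∈ N := hx
    have := (Submodule.mem_orthogonal N _).1 x.2 x hxN
    exact (Submodule.mem_bot ℂ).2 (Subtype.ext (inner_self_eq_zero.1 this))
  have hsurj : A'.range = ⊤ := by
    rw [eq_top_iff]
    intro y _
    obtain ⟨d, rfl⟩ := hA y
    refine ⟨Nᗮ.orthogonalProjectionOnto d, ?_⟩
    have h0 : A (N.starProjection d) = 0 := Submodule.starProjection_apply_mem N d
    change A (Nᗮ.starProjection d) = A d
    rw [Submodule.starProjection_orthogonal_val, map_sub, h0, sub_zero]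
  let e := ContinuousLinearEquiv.ofBijective A' hinj hsurj
  refine ⟨Nᗮ.subtypeL.comp e.symm.toContinuousLinearMap, fun x => ?_⟩
  exact ContinuousLinearEquiv.ofBijective_apply_symm_apply A' hinj hsurj x

/-- The Hilbert model `Y'` of `Y` supplies a bounded projection onto the closed range; it is needed
because `K × K` carries the max norm. -/
theorem exists_leftInverse_of_antilipschitz {U Y Y' : Type*} [NormedAddCommGroup U]
    [NormedSpace ℂ U] [CompleteSpace U] [NormedAddCommGroup Y] [NormedSpace ℂ Y]
    [NormedAddCommGroup Y'] [InnerProductSpace ℂ Y'] [CompleteSpace Y']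
    (e : Y ≃L[ℂ] Y') (A : U →L[ℂ] Y) (c : ℝ) (hA : ∀ u, ‖u‖ ≤ c * ‖A u‖) :
    ∃ C : Y →L[ℂ] U, ∀ u, C (A u) = u := by
  let A' : U →L[ℂ] Y' := e.toContinuousLinearMap.comp A
  have hA' : ∀ u, A' u = e (A u) := fun _ => rfl
  have hinj : Function.Injective A' := by
    rw [injective_iff_map_eq_zero]
    intro u hu
    have hu : A u = 0 := by simpa [hA'] using hu
    have := hA u
    rw [hu, norm_zero, mul_zero] at this
    simpa using this
  have hb : ∀ u, ‖u‖ ≤ (Real.toNNReal (|c| * ‖e.symm.toContinuousLinearMap‖) : NNReal) * ‖A' u‖ := by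
    intro u
    rw [Real.coe_toNNReal _ (by positivity), mul_assoc]
    refine (hA u).trans (mul_le_mul (le_abs_self c) ?_ (norm_nonneg _) (abs_nonneg _))
    have := e.symm.toContinuousLinearMap.le_opNorm (A' u)
    simpa [hA'] using this
  have hcl := (A'.antilipschitz_of_bound hb).isClosed_range A'.uniformContinuous
  let N : Submodule ℂ Y' := A'.range
  have hN : IsClosed (N : Set Y') := hcl
  have : CompleteSpace N := hN.completeSpace_coe
  let f := A'.equivRange hinj hcl
  refine ⟨(f.symm.toContinuousLinearMap.comp N.orthogonalProjectionOnto).comp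
    e.toContinuousLinearMap, fun u => ?_⟩
  change f.symm (N.orthogonalProjectionOnto (A' u)) = u
  rw [ContinuousLinearEquiv.symm_apply_eq]
  exact Submodule.orthogonalProjectionOnto_mem_subspace_eq_self (⟨A' u, u, rfl⟩ : N)

/-- Adding an algebraic complement `C` makes the map onto, hence open; the complement of the range
is then the image of the open set where the `C`-component is nonzero. -/
theorem isClosed_range_of_finiteDimensional_quotient {D X : Type*} [NormedAddCommGroup D]
    [NormedSpace ℂ D] [CompleteSpace D] [NormedAddCommGroup X] [NormedSpace ℂ X]
    [CompleteSpace X] (A : D →L[ℂ] X) [FiniteDimensional ℂ (X ⧸ A.range)] :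
    IsClosed (A.range : Set X) := by
  obtain ⟨C, hC⟩ := Submodule.exists_isCompl (A.range)
  have : FiniteDimensional ℂ C :=
    LinearEquiv.finiteDimensional (Submodule.quotientEquivOfIsCompl _ C hC)
  have : CompleteSpace C := FiniteDimensional.complete ℂ C
  let F : D × C →L[ℂ] X := A.coprod C.subtypeL
  have hF : ∀ p, F p = A p.1 + p.2 := fun _ => rfl
  have hsurj : Function.Surjective F := by
    intro x
    have hx : x ∈ A.range ⊔ C := by rw [hC.sup_eq_top]; trivial
    obtain ⟨_, ⟨d, rfl⟩, c, hc, rfl⟩ := Submodule.mem_sup.1 hx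
    exact ⟨(d, ⟨c, hc⟩), rfl⟩
  rw [← isOpen_compl_iff]
  have hopen : IsOpen {p : D × C | p.2 ≠ 0} := isOpen_ne_fun continuous_snd continuous_const
  convert F.isOpenMap hsurj _ hopen using 1
  ext x
  constructor
  · intro hx
    obtain ⟨p, rfl⟩ := hsurj x
    refine ⟨p, fun h0 => hx ⟨p.1, ?_⟩, rfl⟩
    rw [hF, h0]; simp
  · rintro ⟨p, hp, rfl⟩ hx
    apply hp
    have h1 : (p.2 : X) ∈ A.range := by
      have := (A.range).sub_mem hx (⟨p.1, rfl⟩ : A p.1 ∈ A.range)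
      rwa [hF, add_sub_cancel_left] at this
    exact Subtype.ext ((Submodule.disjoint_def.1 hC.disjoint) _ h1 p.2.2)

/-- If `A` is onto and `Γ` is bounded below on `ker A`, then the images `Γ (ker (A - (z - z₀) ι))`
are the translates of `Γ (ker A)` by an analytic family of bounded invertible operators. -/
theorem exists_analytic_transport {D X Y Y' : Type*} [NormedAddCommGroup D]
    [InnerProductSpace ℂ D] [CompleteSpace D] [NormedAddCommGroup X] [NormedSpace ℂ X]
    [CompleteSpace X] [NormedAddCommGroup Y] [NormedSpace ℂ Y] [CompleteSpace Y]
    [NormedAddCommGroup Y'] [InnerProductSpace ℂ Y'] [CompleteSpace Y']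
    (e : Y ≃L[ℂ] Y') (A ι : D →L[ℂ] X) (Γ : D →L[ℂ] Y) (hA : Function.Surjective A)
    (c : ℝ) (hΓ : ∀ d, A d = 0 → ‖d‖ ≤ c * ‖Γ d‖) (z₀ : ℂ) :
    ∃ G : ℂ → Y →L[ℂ] Y, AnalyticAt ℂ G z₀ ∧ G z₀ = 1 ∧ (∀ᶠ z in 𝓝 z₀, IsUnit (G z)) ∧
      ∀ᶠ z in 𝓝 z₀, ((LinearMap.ker A.toLinearMap).map Γ.toLinearMap).map (G z).toLinearMap =
        (LinearMap.ker (A - (z - z₀) • ι).toLinearMap).map Γ.toLinearMap := by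
  obtain ⟨R, hR⟩ := exists_rightInverse_of_surjective A hA
  let N : Submodule ℂ D := A.ker
  have hN : IsClosed (N : Set D) := A.isClosed_ker
  have : CompleteSpace N := hN.completeSpace_coe
  obtain ⟨C, hC⟩ := exists_leftInverse_of_antilipschitz e (Γ.comp N.subtypeL) c
    (fun u => hΓ u u.2)
  let W : X →L[ℂ] X := ι.comp R
  let V : ℂ → X →L[ℂ] X := fun z => 1 - (z - z₀) • W
  let B : X →L[ℂ] Y := Γ.comp R
  let C' : Y →L[ℂ] X := ι.comp (N.subtypeL.comp C)
  -- For `A d = 0`, the vector `d + (z - z₀) R V⁻¹ ι d` solves the perturbed equation, since `A R =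
  -- 1` and `V = 1 - (z - z₀) ι R`. The left inverse `C` recovers `d` from `Γ d`, so this correction
  -- becomes an operator on `Y`.
  let G : ℂ → Y →L[ℂ] Y := fun z => 1 + (z - z₀) • B.comp ((Ring.inverse (V z)).comp C')
  have hVan : AnalyticAt ℂ V z₀ := by fun_prop
  have hV0 : V z₀ = 1 := by simp [V]
  have hIan : AnalyticAt ℂ (fun z => Ring.inverse (V z)) z₀ := by
    refine AnalyticAt.fun_comp ?_ hVan
    rw [hV0]
    exact analyticAt_inverse (1 : (X →L[ℂ] X)ˣ)
  have hcomp : AnalyticAt ℂ (fun z => B.comp ((Ring.inverse (V z)).comp C')) z₀ := by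
    let Φ : (X →L[ℂ] X) →L[ℂ] (Y →L[ℂ] Y) :=
      (ContinuousLinearMap.compL ℂ Y X Y B).comp ((ContinuousLinearMap.compL ℂ Y X X).flip C')
    exact (Φ.analyticAt _).fun_comp hIan
  have hGan : AnalyticAt ℂ G z₀ :=
    analyticAt_const.add ((analyticAt_id.sub analyticAt_const).smul hcomp)
  have hG0 : G z₀ = 1 := by simp [G]
  refine ⟨G, hGan, hG0, ?_, ?_⟩
  · refine hGan.continuousAt.eventually (Units.isOpen.mem_nhds ?_)
    rw [hG0]; exact isUnit_one
  · have hVu : ∀ᶠ z in 𝓝 z₀, IsUnit (V z) := by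
      refine hVan.continuousAt.eventually (Units.isOpen.mem_nhds ?_)
      rw [hV0]; exact isUnit_one
    filter_upwards [hVu] with z hz
    have hI₁ : ∀ x, V z (Ring.inverse (V z) x) = x := fun x => by
      rw [← mul_apply_eq_comp, Ring.mul_inverse_cancel _ hz]; rfl
    have hI₂ : ∀ x, Ring.inverse (V z) (V z x) = x := fun x => by
      rw [← mul_apply_eq_comp, Ring.inverse_mul_cancel _ hz]; rfl
    have hV : ∀ x, V z x = x - (z - z₀) • ι (R x) := fun x => rfl
    have hG : ∀ d, A d = 0 → G z (Γ d) =
        Γ (d + (z - z₀) • R (Ring.inverse (V z) (ι d))) := by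
      intro d hd
      have : C (Γ d) = ⟨d, hd⟩ := hC ⟨d, hd⟩
      change Γ d + (z - z₀) • Γ (R (Ring.inverse (V z) (ι (C (Γ d))))) = _
      rw [this, map_add, map_smul]
    ext y
    constructor
    · rintro ⟨_, ⟨d, hd, rfl⟩, rfl⟩
      have hd : A d = 0 := hd
      refine ⟨_, ?_, (hG d hd).symm⟩
      change A _ - (z - z₀) • ι _ = 0
      have := hI₁ (ι d)
      rw [hV, sub_eq_iff_eq_add] at this
      rw [map_add, map_smul, hR, hd, zero_add, map_add, map_smul, ← smul_sub, ← this, sub_self,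
        smul_zero]
    · rintro ⟨d, hd, rfl⟩
      have hd : A d - (z - z₀) • ι d = 0 := hd
      have hd' : A (d - R (A d)) = 0 := by rw [map_sub, hR, sub_self]
      refine ⟨_, ⟨d - R (A d), hd', rfl⟩, ?_⟩
      change G z (Γ (d - R (A d))) = Γ d
      rw [hG _ hd', ← map_smul, ← map_smul]
      have : (z - z₀) • ι (d - R (A d)) = V z (A d) := by
        rw [hV, map_sub, smul_sub, ← sub_eq_zero.1 hd]
      rw [this, hI₂, sub_add_cancel]

end Banach

/-! ### The trace map and the a priori estimate in the simple part -/

section Trace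

variable {H : Type*} [NormedAddCommGroup H] [InnerProductSpace ℂ H] [CompleteSpace H]
variable {K : Type*} [NormedAddCommGroup K] [InnerProductSpace ℂ K]

theorem eq_zero_of_omega_eq_zero {u : K × K} (h : ∀ v, omega u v = 0) : u = 0 := by
  have h₁ := h (0, u.1)
  have h₂ := h (u.2, 0)
  simp only [omega, inner_zero_right, sub_zero, zero_sub, neg_eq_zero, inner_self_eq_zero]
    at h₁ h₂
  exact Prod.ext h₁ h₂

variable {S : H →ₗ.[ℂ] H} {M : Submodule ℂ H}

/-- The part in `M` of the graph of `S†`, with the Hilbert space structure of the graph norm. -/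
def adjointGraphIn (S : H →ₗ.[ℂ] H) (M : Submodule ℂ H) : Submodule ℂ (WithLp 2 (H × H)) :=
  (S†.graph ⊓ M.prod M).comap (WithLp.linearEquiv 2 ℂ (H × H)).toLinearMap

theorem isClosed_adjointGraphIn [CompleteSpace M] (hd : Dense (S.domain : Set H)) :
    IsClosed (adjointGraphIn S M : Set (WithLp 2 (H × H))) := by
  have hM : IsClosed (M : Set H) := (completeSpace_coe_iff_isComplete.1 ‹_›).isClosed
  exact ((LinearPMap.adjoint_isClosed hd).inter (hM.prod hM)).preimage
    (WithLp.prod_continuous_ofLp 2 H H)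

/-- The inclusion `f ↦ f` of `dom S†` in `M`. -/
def inclIn (S : H →ₗ.[ℂ] H) (M : Submodule ℂ H) : adjointGraphIn S M →L[ℂ] M :=
  ((WithLp.fstL 2 ℂ H H).comp (adjointGraphIn S M).subtypeL).codRestrict M fun d => d.2.2.1

/-- The operator `f ↦ S† f` in `M`. -/
def adjointIn (S : H →ₗ.[ℂ] H) (M : Submodule ℂ H) : adjointGraphIn S M →L[ℂ] M :=
  ((WithLp.sndL 2 ℂ H H).comp (adjointGraphIn S M).subtypeL).codRestrict M fun d => d.2.2.2

/-- The operator `f ↦ S† f - z f` in `M`. -/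
def shiftIn (S : H →ₗ.[ℂ] H) (M : Submodule ℂ H) (z : ℂ) : adjointGraphIn S M →L[ℂ] M :=
  adjointIn S M - z • inclIn S M

theorem shiftIn_apply (z : ℂ) (d : adjointGraphIn S M) :
    shiftIn S M z d = adjointIn S M d - z • inclIn S M d := rfl

theorem mem_adjointGraphIn (d : adjointGraphIn S M) :
    ((inclIn S M d : H), (adjointIn S M d : H)) ∈ S†.graph := d.2.1

theorem exists_adjointGraphIn {x y : M} (h : ((x : H), (y : H)) ∈ S†.graph) :
    ∃ d : adjointGraphIn S M, inclIn S M d = x ∧ adjointIn S M d = y :=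
  ⟨⟨WithLp.toLp 2 (x, y), h, x.2, y.2⟩, rfl, rfl⟩

theorem norm_le_inclIn_add_adjointIn (d : adjointGraphIn S M) :
    ‖d‖ ≤ ‖inclIn S M d‖ + ‖adjointIn S M d‖ := by
  have h := WithLp.prod_norm_sq_eq_of_L2 (d : WithLp 2 (H × H))
  have h' : ‖d‖ ^ 2 = ‖inclIn S M d‖ ^ 2 + ‖adjointIn S M d‖ ^ 2 := h
  refine (sq_le_sq₀ (norm_nonneg _) (by positivity)).1 ?_
  rw [h', add_sq]
  have : 0 ≤ 2 * ‖inclIn S M d‖ * ‖adjointIn S M d‖ := by positivity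
  linarith

/-- The element of `dom S†` underlying a point of the graph. -/
def domIn (S : H →ₗ.[ℂ] H) (M : Submodule ℂ H) : adjointGraphIn S M →ₗ[ℂ] S†.domain :=
  (M.subtype.comp (inclIn S M).toLinearMap).codRestrict S†.domain fun d =>
    LinearPMap.mem_domain_of_mem_graph (mem_adjointGraphIn d)

theorem adjoint_domIn (d : adjointGraphIn S M) : S† (domIn S M d) = adjointIn S M d := by
  obtain ⟨u, hu, hy⟩ := (LinearPMap.mem_graph_iff _).1 (mem_adjointGraphIn d)
  have : domIn S M d = u := Subtype.ext hu.symm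
  rw [this]
  exact hy

namespace BoundaryTriplet

variable (B : BoundaryTriplet S K)

theorem omega_trace (f g : S†.domain) : omega (B.trace f) (B.trace g) =
    inner ℂ (f : H) (S† g) - inner ℂ (S† f) (g : H) := (B.green f g).symm

/-- If the trace vanishes, Green's identity puts `f` in the domain of `S†† = S`. Conversely it makes
the trace `ω`-orthogonal to all of `K × K`, and `ω` is nondegenerate. -/
theorem trace_eq_zero_iff (hd : Dense (S.domain : Set H)) (hc : S.IsClosed) (f : S†.domain) :
    B.trace f = 0 ↔ ((f : H), S† f) ∈ S.graph := by
  constructor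
  · intro h
    refine mem_graph_of_forall_adjoint hd hc fun a b hab => ?_
    obtain ⟨g, rfl, rfl⟩ := (LinearPMap.mem_graph_iff _).1 hab
    have := B.omega_trace g f
    rw [h] at this
    simp only [omega, Prod.fst_zero, Prod.snd_zero, inner_zero_right, sub_zero] at this
    exact (sub_eq_zero.1 this.symm).symm
  · intro h
    refine eq_zero_of_omega_eq_zero fun v => ?_
    obtain ⟨g, rfl⟩ := B.surjective v
    change omega (B.trace f) (B.trace g) = 0
    rw [omega_trace, sub_eq_zero]
    exact ((mem_adjoint_graph hd).1 (LinearPMap.mem_graph _ g) _ _ h).symm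

/-- The trace map on the part of the graph of `S†` in `M`. -/
def traceIn (M : Submodule ℂ H) : adjointGraphIn S M →ₗ[ℂ] K × K := B.trace.comp (domIn S M)

theorem traceIn_apply (d : adjointGraphIn S M) : B.traceIn M d = B.trace (domIn S M d) := rfl

theorem mem_graph_of_traceIn_eq_zero (hd : Dense (S.domain : Set H))
    (hc : S.IsClosed) {d : adjointGraphIn S M} (h : B.traceIn M d = 0) :
    ((inclIn S M d : H), (adjointIn S M d : H)) ∈ S.graph := by
  have := (B.trace_eq_zero_iff hd hc _).1 h
  rwa [adjoint_domIn] at this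

theorem omega_traceIn (d d' : adjointGraphIn S M) : omega (B.traceIn M d) (B.traceIn M d') =
    inner ℂ (inclIn S M d) (adjointIn S M d') - inner ℂ (adjointIn S M d) (inclIn S M d') := by
  rw [traceIn_apply, traceIn_apply, omega_trace, adjoint_domIn, adjoint_domIn]
  rfl

/-- Closed graph theorem: Green's identity shows that `ω(Γ ·, Γ g)` is continuous for the graph
norm, and these functionals separate points as `Γ` is onto. -/
theorem continuous_traceIn [CompleteSpace K] [CompleteSpace M] (hd : Dense (S.domain : Set H)) :
    Continuous (B.traceIn M) := by
  have : CompleteSpace (adjointGraphIn S M) := (isClosed_adjointGraphIn hd).completeSpace_coe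
  refine LinearMap.continuous_of_seq_closed_graph _ fun u x w hu hw => ?_
  rw [← sub_eq_zero]
  refine eq_zero_of_omega_eq_zero fun v => ?_
  obtain ⟨g, rfl⟩ := B.surjective v
  change omega _ (B.trace g) = 0
  have hlim₁ : Filter.Tendsto (fun n => omega (B.traceIn M (u n)) (B.trace g)) Filter.atTop
      (𝓝 (omega w (B.trace g))) := by
    have hcont : Continuous fun p : K × K => omega p (B.trace g) := by
      unfold omega; fun_prop
    exact (hcont.tendsto w).comp hw
  have hlim₂ : Filter.Tendsto (fun n => omega (B.traceIn M (u n)) (B.trace g)) Filter.atTop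
      (𝓝 (omega (B.traceIn M x) (B.trace g))) := by
    have hom : ∀ d, omega (B.traceIn M d) (B.trace g) =
        inner ℂ (inclIn S M d : H) (S† g) - inner ℂ (adjointIn S M d : H) (g : H) := fun d => by
      rw [traceIn_apply, omega_trace, adjoint_domIn]; rfl
    have hcont : Continuous fun d : adjointGraphIn S M =>
        inner ℂ (inclIn S M d : H) (S† g) - inner ℂ (adjointIn S M d : H) (g : H) := by
      fun_prop
    simp only [hom]
    exact (hcont.tendsto x).comp hu
  have := tendsto_nhds_unique hlim₁ hlim₂
  simp only [omega, Prod.fst_sub, Prod.snd_sub, inner_sub_left] at this ⊢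
  linear_combination this

end BoundaryTriplet

theorem exists_adjointGraphIn_starProjection [CompleteSpace M] (hd : Dense (S.domain : Set H))
    (h : IsReducing S M) {x y : H} (hxy : (x, y) ∈ S†.graph) :
    ∃ d : adjointGraphIn S M, (inclIn S M d : H) = M.starProjection x ∧
      (adjointIn S M d : H) = M.starProjection y := by
  have := isReducing_iff.1 (h.adjoint hd) x y hxy
  obtain ⟨d, h₁, h₂⟩ := exists_adjointGraphIn (x := M.orthogonalProjectionOnto x)
    (y := M.orthogonalProjectionOnto y) this
  exact ⟨d, congrArg Subtype.val h₁, congrArg Subtype.val h₂⟩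

variable [CompleteSpace M]

/-- Projecting to the simple part does not change the trace. -/
theorem IsSimplePart.exists_projection (h : IsSimplePart S M) (hd : Dense (S.domain : Set H))
    (hc : S.IsClosed) (B : BoundaryTriplet S K) (g : S†.domain) :
    ∃ d : adjointGraphIn S M, (inclIn S M d : H) = M.starProjection (g : H) ∧
      (adjointIn S M d : H) = M.starProjection (S† g) ∧ B.traceIn M d = B.trace g := by
  obtain ⟨d, h₁, h₂⟩ := exists_adjointGraphIn_starProjection hd h.reducing
    (LinearPMap.mem_graph _ g)
  refine ⟨d, h₁, h₂, ?_⟩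
  have h₃ := h.sub_starProjection_mem_graph hd (LinearPMap.mem_graph _ g)
  rw [← h₁, ← h₂] at h₃
  have h₄ : B.trace (g - domIn S M d) = 0 := by
    rw [B.trace_eq_zero_iff hd hc, LinearPMap.map_sub, adjoint_domIn]
    exact h₃
  rw [map_sub, sub_eq_zero] at h₄
  exact h₄.symm

theorem IsSimplePart.traceIn_surjective (h : IsSimplePart S M) (hd : Dense (S.domain : Set H))
    (hc : S.IsClosed) (B : BoundaryTriplet S K) : Function.Surjective (B.traceIn M) := by
  intro v
  obtain ⟨g, rfl⟩ := B.surjective v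
  obtain ⟨d, _, _, hd⟩ := h.exists_projection hd hc B g
  exact ⟨d, hd⟩

theorem IsSimplePart.cauchyData_eq (h : IsSimplePart S M) (hd : Dense (S.domain : Set H))
    (hc : S.IsClosed) (B : BoundaryTriplet S K) (z : ℂ) :
    B.cauchyData z = (LinearMap.ker (shiftIn S M z).toLinearMap).map (B.traceIn M) := by
  ext v
  constructor
  · rintro ⟨g, hg, rfl⟩
    obtain ⟨d, h₁, h₂, h₃⟩ := h.exists_projection hd hc B g
    refine ⟨d, ?_, h₃⟩
    have hg : S† g - z • (g : H) = 0 := hg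
    apply Subtype.ext
    change (adjointIn S M d : H) - z • (inclIn S M d : H) = 0
    rw [h₁, h₂, ← map_smul, ← map_sub, hg, map_zero]
  · rintro ⟨d, hd', rfl⟩
    refine ⟨domIn S M d, ?_, rfl⟩
    change S† (domIn S M d) - z • ((inclIn S M d : M) : H) = 0
    rw [adjoint_domIn]
    exact congrArg Subtype.val (show shiftIn S M z d = 0 from hd')

theorem BoundaryTriplet.isPartSolution_iff (B : BoundaryTriplet S K)
    (hd : Dense (S.domain : Set H)) (h : IsReducing S M) (z : ℂ) (v : K × K) (f : M) :
    B.IsPartSolution M z v f ↔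
      ∃ d, inclIn S M d = f ∧ shiftIn S M z d = 0 ∧ B.traceIn M d = v := by
  constructor
  · rintro ⟨⟨h₁, h₂⟩, h₃, rfl⟩
    have hf : (f, z • f) ∈ (part S M)†.graph := by
      rw [← h₂]; exact LinearPMap.mem_graph (part S M)† ⟨f, h₁⟩
    obtain ⟨d, rfl, hd'⟩ := exists_adjointGraphIn ((mem_part_adjoint_graph hd h).1 hf)
    exact ⟨d, rfl, by rw [shiftIn_apply, hd', sub_self], rfl⟩
  · rintro ⟨d, rfl, h₁, rfl⟩
    rw [shiftIn_apply, sub_eq_zero] at h₁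
    refine ⟨?_, LinearPMap.mem_domain_of_mem_graph (mem_adjointGraphIn d), rfl⟩
    obtain ⟨u, hu, hu'⟩ := (LinearPMap.mem_graph_iff _).1
      ((mem_part_adjoint_graph hd h).2 (mem_adjointGraphIn d))
    simp only at hu hu'
    have hm : inclIn S M d ∈ (part S M)†.domain := hu ▸ u.2
    refine ⟨hm, ?_⟩
    rw [← h₁, ← hu']
    congr 1
    exact Subtype.ext hu.symm

theorem IsSimplePart.eq_zero_of_traceIn_eq_zero (h : IsSimplePart S M)
    (hd : Dense (S.domain : Set H)) (hc : S.IsClosed) (hs : S.IsFormalAdjoint S)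
    (B : BoundaryTriplet S K) {d : adjointGraphIn S M} {z : ℂ} (h₁ : shiftIn S M z d = 0)
    (h₂ : B.traceIn M d = 0) : inclIn S M d = 0 := by
  have h₃ := B.mem_graph_of_traceIn_eq_zero hd hc h₂
  rw [shiftIn_apply, sub_eq_zero] at h₁
  rw [h₁] at h₃
  exact Subtype.ext (h.eq_zero_of_smul_mem_graph hs (inclIn S M d).2 h₃)

/-- Finite codimension passes to the projected range and forces it to be closed. A vector orthogonal
to it is an eigenvector of `S` at `conj z` in the simple part, hence zero. -/
theorem IsSimplePart.shiftIn_surjective (h : IsSimplePart S M) (hd : Dense (S.domain : Set H))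
    (hc : S.IsClosed) (hs : S.IsFormalAdjoint S) {z : ℂ} (hz : z ∈ PhiMinus S†) :
    Function.Surjective (shiftIn S M z) := by
  have : CompleteSpace (adjointGraphIn S M) := (isClosed_adjointGraphIn hd).completeSpace_coe
  let R : Submodule ℂ M := (shiftIn S M z).range
  have hle : LinearMap.range (shift S† z) ≤ R.comap M.orthogonalProjectionOnto.toLinearMap := by
    rintro _ ⟨g, rfl⟩
    obtain ⟨d, h₁, h₂⟩ := exists_adjointGraphIn_starProjection hd h.reducing
      (LinearPMap.mem_graph _ g)
    refine ⟨d, Subtype.ext ?_⟩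
    change (adjointIn S M d : H) - z • (inclIn S M d : H) =
      M.starProjection (S† g - z • (g : H))
    rw [h₁, h₂, map_sub, map_smul]
  have hfin : FiniteDimensional ℂ (M ⧸ R) := by
    have : FiniteDimensional ℂ (H ⧸ LinearMap.range (shift S† z)) := hz
    refine Module.Finite.of_surjective
      (Submodule.mapQ _ R M.orthogonalProjectionOnto.toLinearMap hle) ?_
    intro q
    obtain ⟨y, rfl⟩ := Submodule.mkQ_surjective _ q
    refine ⟨Submodule.Quotient.mk (y : H), ?_⟩
    rw [Submodule.mapQ_apply]
    change Submodule.Quotient.mk (M.orthogonalProjectionOnto (y : H)) = _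
    rw [Submodule.orthogonalProjectionOnto_mem_subspace_eq_self]
    rfl
  have hRc : IsClosed (R : Set M) := isClosed_range_of_finiteDimensional_quotient (shiftIn S M z)
  have : CompleteSpace R := hRc.completeSpace_coe
  have hbot : Rᗮ = ⊥ := by
    rw [eq_bot_iff]
    intro y hy
    rw [Submodule.mem_orthogonal'] at hy
    have hy' : ((y : H), (starRingEnd ℂ) z • (y : H)) ∈ S.graph := by
      refine mem_graph_of_forall_adjoint hd hc fun a b hab => ?_
      obtain ⟨d, h₁, h₂⟩ := exists_adjointGraphIn_starProjection hd h.reducing hab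
      have hyd : inner ℂ (y : H) ((adjointIn S M d : H) - z • (inclIn S M d : H)) = (0 : ℂ) :=
        hy _ ⟨d, rfl⟩
      rw [h₁, h₂, ← map_smul, ← map_sub, ← Submodule.inner_starProjection_left_eq_right,
        Submodule.starProjection_eq_self_iff.2 y.2, inner_sub_right, inner_smul_right,
        sub_eq_zero] at hyd
      rw [inner_smul_right, ← inner_conj_symm b, hyd, map_mul, inner_conj_symm]
    exact (Submodule.mem_bot ℂ).2 (Subtype.ext (h.eq_zero_of_smul_mem_graph hs y.2 hy'))
  rw [Submodule.orthogonal_eq_bot_iff] at hbot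
  exact LinearMap.range_eq_top.1 hbot

theorem IsSimplePart.exists_norm_le_of_mem_graph (h : IsSimplePart S M)
    (hd : Dense (S.domain : Set H)) (hc : S.IsClosed) (hs : S.IsFormalAdjoint S) {z : ℂ}
    (hz : z ∈ PhiMinus S†) :
    ∃ c, 0 ≤ c ∧ ∀ x ∈ M, ∀ y, (x, y) ∈ S.graph → ‖x‖ ≤ c * ‖y - z • x‖ := by
  by_cases hreal : z.im = 0
  -- At real `z` symmetry alone gives no lower bound. Duality does: with a bounded right inverse `W`
  -- of `S† - z`, one has `‖x‖² = ⟪(S - z) x, W x⟫`.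
  · have : CompleteSpace (adjointGraphIn S M) := (isClosed_adjointGraphIn hd).completeSpace_coe
    obtain ⟨R, hR⟩ := exists_rightInverse_of_surjective _ (h.shiftIn_surjective hd hc hs hz)
    let W := (inclIn S M).comp R
    refine ⟨‖W‖, norm_nonneg _, fun x hx y hxy => ?_⟩
    have h₁ : (adjointIn S M (R ⟨x, hx⟩) : H) - z • (W ⟨x, hx⟩ : H) = x :=
      congrArg Subtype.val (hR ⟨x, hx⟩)
    have h₂ : inner ℂ y (inclIn S M (R ⟨x, hx⟩) : H) =
        inner ℂ x (adjointIn S M (R ⟨x, hx⟩) : H) :=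
      (mem_adjoint_graph hd).1 (mem_adjointGraphIn (R ⟨x, hx⟩)) _ _ hxy
    have h₃ : inner ℂ x x = inner ℂ (y - z • x) (W ⟨x, hx⟩ : H) := by
      have h₀ : inner ℂ x ((adjointIn S M (R ⟨x, hx⟩) : H) - z • (W ⟨x, hx⟩ : H)) =
          inner ℂ x x := by rw [h₁]
      rw [← h₀, inner_sub_right, inner_sub_left, inner_smul_left, inner_smul_right,
        Complex.conj_eq_iff_im.2 hreal, ← h₂]
      rfl
    have h₄ : ‖x‖ ^ 2 ≤ ‖y - z • x‖ * (‖W‖ * ‖x‖) := by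
      have e₁ : ‖(inner ℂ x x : ℂ)‖ = ‖x‖ ^ 2 := by
        rw [inner_self_eq_norm_sq_to_K]; simp
      rw [← e₁, h₃]
      refine (norm_inner_le_norm _ _).trans ?_
      exact mul_le_mul_of_nonneg_left (W.le_opNorm ⟨x, hx⟩) (norm_nonneg _)
    rcases (norm_nonneg x).eq_or_lt with h0 | h0
    · rw [← h0]; positivity
    · refine le_of_mul_le_mul_left ?_ h0
      linarith
  · have hz' : 0 < |z.im| := abs_pos.2 hreal
    refine ⟨|z.im|⁻¹, by positivity, fun x _ y hxy => ?_⟩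
    rw [inv_mul_eq_div, le_div_iff₀ hz', mul_comm]
    exact abs_im_mul_norm_le hs z hxy

/-- The a priori estimate of an element of `dom S†` in the simple part by its trace and its image
under `S† - z`. -/
theorem IsSimplePart.exists_norm_le [CompleteSpace K] (h : IsSimplePart S M)
    (hd : Dense (S.domain : Set H)) (hc : S.IsClosed) (hs : S.IsFormalAdjoint S)
    (B : BoundaryTriplet S K) {z : ℂ} (hz : z ∈ PhiMinus S†) :
    ∃ C, 0 ≤ C ∧ ∀ d, ‖d‖ ≤ C * (‖B.traceIn M d‖ + ‖shiftIn S M z d‖) := by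
  have : CompleteSpace (adjointGraphIn S M) := (isClosed_adjointGraphIn hd).completeSpace_coe
  obtain ⟨c, hc0, hcb⟩ := h.exists_norm_le_of_mem_graph hd hc hs hz
  let Γ : adjointGraphIn S M →L[ℂ] K × K := ⟨B.traceIn M, B.continuous_traceIn hd⟩
  obtain ⟨k, hk0, hk⟩ := Γ.exists_preimage_norm_le (h.traceIn_surjective hd hc B)
  let A := shiftIn S M z
  -- With `e` a bounded lift of the trace of `d`, the difference `d - e` lies in the graph of `S`.
  -- The summand `k` bounds `e`; the others bound the two components of `d - e`.
  refine ⟨k + (1 + ‖z‖) * (c * (1 + ‖A‖ * k)) + (1 + ‖A‖ * k), by positivity, fun d => ?_⟩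
  obtain ⟨e, he, hek⟩ := hk (B.traceIn M d)
  have h0 : B.traceIn M (d - e) = 0 := by
    rw [map_sub, sub_eq_zero]; exact he.symm
  have h₁ := hcb _ (inclIn S M (d - e)).2 _ (B.mem_graph_of_traceIn_eq_zero hd hc h0)
  have h₁' : ‖inclIn S M (d - e)‖ ≤ c * ‖A (d - e)‖ := h₁
  have h₂ : ‖A (d - e)‖ ≤ ‖A d‖ + ‖A‖ * (k * ‖B.traceIn M d‖) := by
    rw [map_sub]
    refine (norm_sub_le _ _).trans (add_le_add_right ?_ _)
    exact (A.le_opNorm e).trans (mul_le_mul_of_nonneg_left hek A.opNorm_nonneg)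
  have h₃ : ‖adjointIn S M (d - e)‖ ≤ ‖A (d - e)‖ + ‖z‖ * ‖inclIn S M (d - e)‖ := by
    have : adjointIn S M (d - e) = A (d - e) + z • inclIn S M (d - e) := by
      rw [shiftIn_apply, sub_add_cancel]
    rw [this]
    exact (norm_add_le _ _).trans (by rw [norm_smul])
  have h₄ : ‖d‖ ≤ ‖d - e‖ + ‖e‖ := by
    simpa using norm_add_le (d - e) e
  have h₅ := norm_le_inclIn_add_adjointIn (d - e)
  set a := ‖A d‖
  set t := ‖B.traceIn M d‖
  have ha : 0 ≤ a := norm_nonneg _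
  have ht : 0 ≤ t := norm_nonneg _
  have hA := norm_nonneg A
  have hz0 := norm_nonneg z
  have h₆ : a + ‖A‖ * (k * t) ≤ (1 + ‖A‖ * k) * (t + a) := by
    have : 0 ≤ ‖A‖ * k * a := by positivity
    nlinarith
  have h₇ : ‖A (d - e)‖ ≤ (1 + ‖A‖ * k) * (t + a) := h₂.trans h₆
  have h₈ : ‖inclIn S M (d - e)‖ ≤ c * ((1 + ‖A‖ * k) * (t + a)) :=
    h₁'.trans (mul_le_mul_of_nonneg_left h₇ hc0)
  have h₉ : ‖z‖ * ‖inclIn S M (d - e)‖ ≤ ‖z‖ * (c * ((1 + ‖A‖ * k) * (t + a))) :=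
    mul_le_mul_of_nonneg_left h₈ hz0
  have h₁₀ : k * t ≤ k * (t + a) := mul_le_mul_of_nonneg_left (by linarith) hk0.le
  calc ‖d‖ ≤ c * ((1 + ‖A‖ * k) * (t + a)) + ((1 + ‖A‖ * k) * (t + a) +
        ‖z‖ * (c * ((1 + ‖A‖ * k) * (t + a)))) + k * (t + a) := by linarith
    _ = _ := by ring

end Trace

/-! ### Transport, minimal norm and the crossing form -/

section Main

variable {H : Type*} [NormedAddCommGroup H] [InnerProductSpace ℂ H] [CompleteSpace H]
variable {K : Type*} [NormedAddCommGroup K] [InnerProductSpace ℂ K]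
variable {S : H →ₗ.[ℂ] H} {M : Submodule ℂ H} [CompleteSpace M]

theorem IsSimplePart.exists_isTransport [CompleteSpace K] (h : IsSimplePart S M) (hd : Dense (S.domain : Set H))
    (hc : S.IsClosed) (hs : S.IsFormalAdjoint S) (B : BoundaryTriplet S K) {z₀ : ℂ}
    (hz : z₀ ∈ PhiMinus S†) : ∃ G, B.IsTransport z₀ G := by
  have : CompleteSpace (adjointGraphIn S M) := (isClosed_adjointGraphIn hd).completeSpace_coe
  let Γ : adjointGraphIn S M →L[ℂ] K × K := ⟨B.traceIn M, B.continuous_traceIn hd⟩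
  obtain ⟨C, _, hC⟩ := h.exists_norm_le hd hc hs B hz
  obtain ⟨G, h₁, h₂, h₃, h₄⟩ := exists_analytic_transport
    (WithLp.prodContinuousLinearEquiv 2 ℂ K K).symm (shiftIn S M z₀) (inclIn S M) Γ
    (h.shiftIn_surjective hd hc hs hz) C
    (fun d hd' => (hC d).trans_eq (by rw [hd', norm_zero, add_zero]; rfl)) z₀
  refine ⟨G, h₁, h₂, h₃, h₄.mono fun z hz' => ?_⟩
  have hshift : shiftIn S M z₀ - (z - z₀) • inclIn S M = shiftIn S M z := by
    refine ContinuousLinearMap.ext fun d => ?_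
    change shiftIn S M z₀ d - (z - z₀) • inclIn S M d = _
    rw [shiftIn_apply, shiftIn_apply, sub_sub, ← add_smul, add_sub_cancel]
  rw [hshift] at hz'
  rw [h.cauchyData_eq hd hc B, h.cauchyData_eq hd hc B]
  exact hz'

theorem IsSimplePart.inclIn_eq_of_traceIn_eq (h : IsSimplePart S M)
    (hd : Dense (S.domain : Set H)) (hc : S.IsClosed) (hs : S.IsFormalAdjoint S)
    (B : BoundaryTriplet S K) {z : ℂ} {d d' : adjointGraphIn S M} (h₁ : shiftIn S M z d = 0)
    (h₁' : shiftIn S M z d' = 0) (h₂ : B.traceIn M d = B.traceIn M d') :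
    inclIn S M d = inclIn S M d' := by
  rw [← sub_eq_zero, ← map_sub]
  exact h.eq_zero_of_traceIn_eq_zero hd hc hs B (z := z) (by rw [map_sub, h₁, h₁', sub_zero])
    (by rw [map_sub, h₂, sub_self])

theorem IsSimplePart.existsUnique_isPartSolution (h : IsSimplePart S M)
    (hd : Dense (S.domain : Set H)) (hc : S.IsClosed) (hs : S.IsFormalAdjoint S)
    (B : BoundaryTriplet S K) {z : ℂ} {v : K × K} (hv : v ∈ B.cauchyData z) :
    ∃! f : M, B.IsPartSolution M z v f := by
  simp only [B.isPartSolution_iff hd h.reducing]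
  rw [h.cauchyData_eq hd hc B] at hv
  obtain ⟨d, hd', rfl⟩ := hv
  refine ⟨inclIn S M d, ⟨d, rfl, hd', rfl⟩, ?_⟩
  rintro _ ⟨d', rfl, h₁, h₂⟩
  exact h.inclIn_eq_of_traceIn_eq hd hc hs B h₁ hd' h₂

theorem IsSimplePart.isLeast_norm_sq (h : IsSimplePart S M)
    (hd : Dense (S.domain : Set H)) (hc : S.IsClosed) (hs : S.IsFormalAdjoint S)
    (B : BoundaryTriplet S K) {z : ℂ} {v : K × K} {f : M} (hf : B.IsPartSolution M z v f) :
    IsLeast ((fun g : S†.domain => ‖(g : H)‖ ^ 2) ''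
      {g | shift S† z g = 0 ∧ B.trace g = v}) (‖f‖ ^ 2) := by
  obtain ⟨d, rfl, h₁, h₂⟩ := (B.isPartSolution_iff hd h.reducing z v f).1 hf
  constructor
  · refine ⟨domIn S M d, ⟨?_, h₂⟩, rfl⟩
    change S† (domIn S M d) - z • (inclIn S M d : H) = 0
    rw [adjoint_domIn]
    exact congrArg Subtype.val h₁
  · rintro _ ⟨g, ⟨hg₁, hg₂⟩, rfl⟩
    obtain ⟨e, he₁, he₂, he₃⟩ := h.exists_projection hd hc B g
    have hg₁ : S† g - z • (g : H) = 0 := hg₁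
    have he : shiftIn S M z e = 0 := by
      apply Subtype.ext
      change (adjointIn S M e : H) - z • (inclIn S M e : H) = 0
      rw [he₁, he₂, ← map_smul, ← map_sub, hg₁, map_zero]
    have hde := h.inclIn_eq_of_traceIn_eq hd hc hs B h₁ he (by rw [h₂, he₃, hg₂])
    change ‖inclIn S M d‖ ^ 2 ≤ ‖(g : H)‖ ^ 2
    have : ‖inclIn S M d‖ ≤ ‖(g : H)‖ := by
      rw [hde, Submodule.coe_norm, he₁]
      exact M.norm_starProjection_apply_le g
    gcongr

theorem IsSimplePart.hasDerivAt_omega [CompleteSpace K] (h : IsSimplePart S M)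
    (hd : Dense (S.domain : Set H)) (hc : S.IsClosed) (hs : S.IsFormalAdjoint S)
    (B : BoundaryTriplet S K) {z₀ : ℂ} (hz₀ : z₀ ∈ PhiMinus S†) (hreal : z₀.im = 0)
    {v : K × K} (hv : v ∈ B.cauchyData z₀) {f : M} (hf : B.IsPartSolution M z₀ v f)
    {G : ℂ → (K × K) →L[ℂ] (K × K)} (hG : B.IsTransport z₀ G) :
    HasDerivAt (fun z => omega v (G z v)) ((‖f‖ ^ 2 : ℝ) : ℂ) z₀ := by
  obtain ⟨d, rfl, h₁, rfl⟩ := (B.isPartSolution_iff hd h.reducing z₀ v f).1 hf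
  obtain ⟨C, hC0, hC⟩ := h.exists_norm_le hd hc hs B hz₀
  set v := B.traceIn M d with hvd
  have hsol : ∀ᶠ z in 𝓝 z₀, ∃ e, shiftIn S M z e = 0 ∧ B.traceIn M e = G z v := by
    filter_upwards [hG.map_eq] with z hz
    have : G z v ∈ B.cauchyData z := by rw [← hz]; exact ⟨v, hv, rfl⟩
    rw [h.cauchyData_eq hd hc B] at this
    exact this
  -- The choice of `e z` is arbitrary; its convergence comes later from the a priori estimate.
  obtain ⟨e, he⟩ := hsol.choice
  have homega : ∀ᶠ z in 𝓝 z₀,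
      omega v (G z v) = (z - z₀) * inner ℂ (inclIn S M d) (inclIn S M (e z)) := by
    filter_upwards [he] with z hz
    rw [← hz.2, hvd, B.omega_traceIn, sub_eq_zero.1 ((shiftIn_apply _ _).symm.trans hz.1),
      sub_eq_zero.1 ((shiftIn_apply _ _).symm.trans h₁), inner_smul_left, inner_smul_right,
      Complex.conj_eq_iff_im.2 hreal, sub_mul]
  have hnorm : ∀ x : adjointGraphIn S M, ‖inclIn S M x‖ ≤ ‖x‖ := fun x =>
    WithLp.norm_fst_le H (x : WithLp 2 (H × H))
  have hGv : Filter.Tendsto (fun z => ‖G z v - v‖) (𝓝 z₀) (𝓝 0) := by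
    have : ContinuousAt (fun z => ‖G z v - v‖) z₀ := by
      have := hG.analytic.continuousAt
      fun_prop
    have h0 : ‖G z₀ v - v‖ = 0 := by rw [hG.at_base]; simp
    rw [← h0]
    exact this
  have hzz : Filter.Tendsto (fun z => ‖z - z₀‖) (𝓝 z₀) (𝓝 0) := by
    have : ContinuousAt (fun z => ‖z - z₀‖) z₀ := by fun_prop
    have h0 : ‖z₀ - z₀‖ = 0 := by simp
    rw [← h0]
    exact this
  have hsmall : ∀ᶠ z in 𝓝 z₀, C * ‖z - z₀‖ ≤ 1 / 2 := by
    have := hzz.const_mul C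
    rw [mul_zero] at this
    exact this.eventually_le_const (by norm_num)
  have hlim : Filter.Tendsto (fun z => inclIn S M (e z)) (𝓝 z₀) (𝓝 (inclIn S M d)) := by
    rw [tendsto_iff_norm_sub_tendsto_zero]
    have hb : Filter.Tendsto
        -- The difference `e z - d` has trace `G z v - v` and image `(z - z₀) f_z` under `S† - z₀`.
        -- Splitting `f_z = (f_z - f) + f` and absorbing the first term, as `C ‖z - z₀‖ ≤ 1/2`,
        -- doubles the constant.
        (fun z => 2 * C * (‖G z v - v‖ + ‖z - z₀‖ * ‖inclIn S M d‖)) (𝓝 z₀) (𝓝 0) := by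
      simpa using (hGv.add (hzz.mul_const ‖inclIn S M d‖)).const_mul (2 * C)
    refine squeeze_zero' (Filter.Eventually.of_forall fun _ => norm_nonneg _) ?_ hb
    filter_upwards [he, hsmall] with z hz hsm
    have h₂ := (hnorm _).trans (hC (e z - d))
    have h₃ : shiftIn S M z₀ (e z - d) = (z - z₀) • inclIn S M (e z) := by
      rw [map_sub, h₁, sub_zero, shiftIn_apply, sub_eq_zero.1 ((shiftIn_apply _ _).symm.trans hz.1),
        sub_smul]
    have h₄ : ‖inclIn S M (e z)‖ ≤ ‖inclIn S M (e z) - inclIn S M d‖ + ‖inclIn S M d‖ := by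
      simpa using norm_add_le (inclIn S M (e z) - inclIn S M d) (inclIn S M d)
    rw [h₃, norm_smul, map_sub, map_sub, hz.2, ← hvd] at h₂
    have h₅ : C * ‖z - z₀‖ * ‖inclIn S M (e z) - inclIn S M d‖ ≤
        1 / 2 * ‖inclIn S M (e z) - inclIn S M d‖ :=
      mul_le_mul_of_nonneg_right hsm (norm_nonneg _)
    have h₆ : C * ‖z - z₀‖ * ‖inclIn S M (e z)‖ ≤
        C * ‖z - z₀‖ * (‖inclIn S M (e z) - inclIn S M d‖ + ‖inclIn S M d‖) :=
      mul_le_mul_of_nonneg_left h₄ (by positivity)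
    linarith
  have hinner : Filter.Tendsto (fun z => (inner ℂ (inclIn S M d) (inclIn S M (e z)) : ℂ)) (𝓝 z₀)
      (𝓝 ((‖inclIn S M d‖ ^ 2 : ℝ) : ℂ)) := by
    have : (inner ℂ (inclIn S M d) (inclIn S M d) : ℂ) = ((‖inclIn S M d‖ ^ 2 : ℝ) : ℂ) := by
      rw [inner_self_eq_norm_sq_to_K]; simp
    rw [← this]
    exact tendsto_const_nhds.inner hlim
  rw [hasDerivAt_iff_tendsto_slope]
  refine (hinner.mono_left nhdsWithin_le_nhds).congr' ?_
  have hbase : omega v (G z₀ v) = 0 := by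
    rw [homega.self_of_nhds, sub_self, zero_mul]
  filter_upwards [homega.filter_mono nhdsWithin_le_nhds, self_mem_nhdsWithin] with z hz hne
  rw [slope_def_field, hbase, hz, sub_zero, mul_div_cancel_left₀ _ (sub_ne_zero.2 hne)]

end Main

end CauchyData

end

theorem corollary4p2
    {H : Type*} [NormedAddCommGroup H] [InnerProductSpace ℂ H] [CompleteSpace H]
    {K : Type*} [NormedAddCommGroup K] [InnerProductSpace ℂ K] [CompleteSpace K]
    (S : H →ₗ.[ℂ] H) (hdense : Dense (S.domain : Set H)) (hclosed : S.IsClosed)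
    (hsymm : S.IsFormalAdjoint S)
    (B : CauchyData.BoundaryTriplet S K)
    (z₀ : ℂ) (hz₀ : z₀ ∈ CauchyData.PhiMinus S†) :
    -- the splitting of `H` and the family `G` exist
    (∃ (Hsim : Submodule ℂ H) (_ : CompleteSpace Hsim), CauchyData.IsSimplePart S Hsim) ∧
    (∃ G : ℂ → (K × K) →L[ℂ] (K × K), B.IsTransport z₀ G) ∧
    ∀ (Hsim : Submodule ℂ H) [CompleteSpace Hsim], CauchyData.IsSimplePart S Hsim →
      ∀ v ∈ B.cauchyData z₀,
        (∃! f : Hsim, B.IsPartSolution Hsim z₀ v f) ∧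
        ∀ f : Hsim, B.IsPartSolution Hsim z₀ v f →
          IsLeast ((fun g : S†.domain => ‖(g : H)‖ ^ 2) ''
              {g | CauchyData.shift S† z₀ g = 0 ∧ B.trace g = v}) (‖f‖ ^ 2) ∧
          (z₀.im = 0 → ∀ G : ℂ → (K × K) →L[ℂ] (K × K), B.IsTransport z₀ G →
            HasDerivAt (fun z => CauchyData.omega v (G z v)) ((‖f‖ ^ 2 : ℝ) : ℂ) z₀) := by
  obtain ⟨M, hM, h⟩ := CauchyData.exists_isSimplePart hclosed hsymm
  refine ⟨⟨M, hM, h⟩, h.exists_isTransport hdense hclosed hsymm B hz₀, ?_⟩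
  intro Hsim _ hsim v hv
  refine ⟨hsim.existsUnique_isPartSolution hdense hclosed hsymm B hv, fun f hf =>
    ⟨hsim.isLeast_norm_sq hdense hclosed hsymm B hf, fun hreal G hG => ?_⟩⟩
  exact hsim.hasDerivAt_omega hdense hclosed hsymm B hz₀ hreal hv hf hG
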